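/- Let $(\Omega,\mathcal A,P)$ be a probability space, let $m$ be the number of firms and let $2\le r<\infty$, $r'=r/(r-1)$. Let $f_i:\Omega\times\mathbb R\to\mathbb R$ ($i=1,\dots,m$) be the random cost functions and $p:\Omega\times\mathbb R\to\mathbb R$ the random demand price, such that $f_i(\cdot,x)$ and $p(\cdot,x)$ are measurable for every $x\in\mathbb R$ and, for $P$-almost every $\omega$, $f_i(\omega,\cdot)$ and $p(\omega,\cdot)$ are of class $C^1$. Let $\overline q_i\in L^r(\Omega,P)$ be the production bounds, $\overline q_i\ge 0$ almost surely. For $q\in\mathbb R^m$ and $Q=\sum_{j=1}^m q_j$ put $$F_i(\omega,q)=f_i'(\omega,q_i)-p'(\omega,Q)\,q_i-p(\omega,Q),\qquad i=1,\dots,m,$$ where $'$ denotes the derivative in the second variable; that is, $F_i=-\partial w_i/\partial q_i$ for the welfare $w_i(\omega,q)=p(\omega,Q)q_i-f_i(\omega,q_i)$. Assume that, for $P$-almost every $\omega$, $F(\omega,\cdot)$ is strictly monotone on $\mathbb R^m_+=[0,\infty)^m$, i.e. $$\sum_{i=1}^m\bigl(F_i(\omega,q)-F_i(\omega,q')\bigr)(q_i-q_i')>0\qquad\text{for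 all } q\ne q' \text{ in } \mathbb R^m_+,$$ and that $F$ satisfies the growth condition $$|F_i(\omega,q)|\le\alpha(\omega)+\beta_i(\omega)\,|q|^{r-1}\qquad\text{for all } q\in\mathbb R^m_+,\ i=1,\dots,m,$$ for $P$-almost every $\omega$, with some $\alpha\in L^{r'}(\Omega,P)$ and $\beta_i\in L^\infty(\Omega,P)$, where $|\cdot|$ is the Euclidean norm. Let $$K=\{u\in L^r(\Omega,P,\mathbb R^m):\ 0\le u_i(\omega)\le\overline q_i(\omega)\ \text{for all } i,\ P\text{-a.s.}\}.$$ Then there is a unique $u^*\in K$ such that, for every $u\in K$, the function $\omega\mapsto\sum_{i=1}^m F_i(\omega,u^*(\omega))\,(u_i(\omega)-u_i^*(\omega))$ is integrable and $$\int_\Omega\sum_{i=1}^m\Bigl[f_i'(\omega,u_i^*(\omega))-p'\Bigl(\omega,\sum_{j=1}^m u_j^*(\omega)\Bigr)u_i^*(\omega)-p\Bigl(\omega,\sum_{j=1}^m u_j^*(\omega)\Bigr)\Bigr]\,(u_i(\omega)-u_i^*(\omega))\,dP(\omega)\ \ge\ 0.$$ -/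

import Mathlib

open MeasureTheory

noncomputable section

namespace Cournot

/-- The welfare (net revenue) `w_i(q) = p(Q) q_i - f_i(q_i)`, `Q = q_1 + ... + q_m`, of firm `i`
at one fixed state of nature, for cost functions `f` and inverse demand (price) function `p`. -/
def welfare {m : ℕ} (f : Fin m → ℝ → ℝ) (p : ℝ → ℝ) (i : Fin m)
    (q : EuclideanSpace ℝ (Fin m)) : ℝ :=
  p (∑ j, q j) * q i - f i (q i)

/-- The `i`-th component `F_i(q) = f_i'(q_i) - p'(Q) q_i - p(Q)`, `Q = q_1 + ... + q_m`, of the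
Cournot operator at one fixed state of nature. -/
def operator {m : ℕ} (f : Fin m → ℝ → ℝ) (p : ℝ → ℝ) (q : EuclideanSpace ℝ (Fin m))
    (i : Fin m) : ℝ :=
  deriv (f i) (q i) - deriv p (∑ j, q j) * q i - p (∑ j, q j)

/-- Check of the definition: `F_i` is minus the partial derivative of the welfare of firm `i` in its own quantity. -/
theorem hasDerivAt_welfare {m : ℕ} (f : Fin m → ℝ → ℝ) (p : ℝ → ℝ) (i : Fin m)
    (q : EuclideanSpace ℝ (Fin m)) (hf : DifferentiableAt ℝ (f i) (q i))
    (hp : DifferentiableAt ℝ p (∑ j, q j)) :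
    HasDerivAt (fun t : ℝ => welfare f p i (q + t • EuclideanSpace.single i (1 : ℝ)))
      (-operator f p q i) 0 := by
  have h1 : ∀ t : ℝ, welfare f p i (q + t • EuclideanSpace.single i (1 : ℝ))
      = p ((∑ j, q j) + t) * (q i + t) - f i (q i + t) := by
    intro t
    simp [welfare, Finset.sum_add_distrib]
  simp only [h1]
  have hid (c : ℝ) : HasDerivAt (fun t : ℝ => c + t) 1 0 := (hasDerivAt_id 0).const_add c
  have hp' : HasDerivAt p (deriv p (∑ j, q j)) ((∑ j, q j) + 0) := by
    simpa using hp.hasDerivAt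
  have hf' : HasDerivAt (f i) (deriv (f i) (q i)) (q i + 0) := by
    simpa using hf.hasDerivAt
  have h := ((hp'.comp 0 (hid _)).mul (hid (q i))).sub (hf'.comp 0 (hid (q i)))
  have hv : -operator f p q i = deriv p (∑ j, q j) * 1 * (q i + 0)
      + (p ∘ HAdd.hAdd (∑ j, q j)) 0 * 1 - deriv (f i) (q i) * 1 := by
    simp [operator]
    ring
  rw [hv]
  exact h

/-- Strict monotonicity of an operator on the set of nonnegative production vectors. -/
def StrictlyMonotone {m : ℕ} (F : EuclideanSpace ℝ (Fin m) → Fin m → ℝ) : Prop :=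
  ∀ q q' : EuclideanSpace ℝ (Fin m), (∀ i, 0 ≤ q i) → (∀ i, 0 ≤ q' i) → q ≠ q' →
    0 < ∑ i, (F q i - F q' i) * (q i - q' i)

/-- The box `K = {u ∈ L^r(Ω, P, ℝ^m) : 0 ≤ u_i ≤ qbar_i almost surely, for all i}`. -/
def feasibleSet {Ω : Type*} [MeasurableSpace Ω] {m : ℕ} (P : Measure Ω) (r : ℝ) (qbar : Fin m → Ω → ℝ) :
    Set (Lp (EuclideanSpace ℝ (Fin m)) (ENNReal.ofReal r) P) :=
  {u | ∀ᵐ ω ∂P, ∀ i, 0 ≤ u ω i ∧ u ω i ≤ qbar i ω}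

/-- `ustar ∈ K` solves the variational inequality
`∫ ∑ i, F_i(ω, ustar(ω)) (u_i(ω) - ustar_i(ω)) dP ≥ 0` for all `u ∈ K`
(where the integrals are required to exist). -/
def IsSolution {Ω : Type*} [MeasurableSpace Ω] {m : ℕ} (P : Measure Ω) (r : ℝ) (f : Fin m → Ω → ℝ → ℝ) (p : Ω → ℝ → ℝ)
    (qbar : Fin m → Ω → ℝ) (ustar : Lp (EuclideanSpace ℝ (Fin m)) (ENNReal.ofReal r) P) : Prop :=
  ustar ∈ feasibleSet P r qbar ∧
    ∀ u ∈ feasibleSet P r qbar,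
      Integrable (fun ω => ∑ i, operator (fun j => f j ω) (p ω) (ustar ω) i
        * (u ω i - ustar ω i)) P ∧
      0 ≤ ∫ ω, ∑ i, operator (fun j => f j ω) (p ω) (ustar ω) i * (u ω i - ustar ω i) ∂P

end Cournot

end

/-! ### Monotone variational inequalities on compact convex sets -/

open scoped RealInnerProductSpace

/-! The constraints defining `K` are pointwise, so the problem is solved separately for each ω on
the box ∏ [0, qbar_i(ω)], and the resulting inequality is integrated. At fixed ω, existence is
Minty's argument: the Minty inequalities for finitely many points have a common solution
(Hahn–Banach separation and monotonicity), compactness gives one for all points, and continuity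
turns it into a solution of the variational inequality. Strict monotonicity makes it unique. The
solution is the unique zero of the residual of the projection equation x = proj(x - F(x)). This
residual is measurable in ω and continuous in x, so its zero is measurable in ω. Domination by
`qbar` puts it in L^r; the growth condition puts F(u) in L^{r'}, and Hölder gives integrability. For
uniqueness in L^r, two solutions are tested against each other: strict monotonicity leaves an a.e.
nonnegative integrand with integral at most 0. -/

/-- Among finitely many points of a convex set, a monotone operator admits a common solution of
the Minty inequalities. -/
theorem exists_forall_finset_inner_sub_nonpos {E : Type*} [NormedAddCommGroup E]
    [InnerProductSpace ℝ E] {K : Set E} (hK : IsCompact K) (hconv : Convex ℝ K)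
    (hne : K.Nonempty) {G : E → E} (hG : ∀ x ∈ K, ∀ y ∈ K, 0 ≤ ⟪G x - G y, x - y⟫)
    (s : Finset K) : ∃ x ∈ K, ∀ y ∈ s, ⟪G y, x - y⟫ ≤ 0 := by
  classical
  by_contra! hcon
  let Φ : E → (s → ℝ) := fun x y => ⟪G y, x - y⟫
  have hΦc : Continuous Φ := by fun_prop
  have hA : Convex ℝ (Φ '' K) := by
    rintro _ ⟨x, hx, rfl⟩ _ ⟨z, hz, rfl⟩ a b ha hb hab
    refine ⟨a • x + b • z, hconv hx hz ha hb hab, ?_⟩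
    ext y
    have : a • x + b • z - (y : E) = a • (x - y) + b • (z - y) := by
      rw [smul_sub, smul_sub]
      nth_rewrite 1 [← one_smul ℝ (y : E)]
      rw [← hab, add_smul]
      abel
    simp only [Φ, this, inner_add_right, inner_smul_right, Pi.add_apply, Pi.smul_apply,
      smul_eq_mul]
  -- If no common solution exists, the compact convex image of the affine map `Φ` misses the
  -- nonpositive orthant, so the two can be strictly separated.
  have hdisj : Disjoint (Φ '' K) (Set.Iic 0) := by
    rw [Set.disjoint_left]
    rintro _ ⟨x, hx, rfl⟩ hle
    obtain ⟨y, hy, hlt⟩ := hcon x hx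
    exact absurd (hle ⟨y, hy⟩) (not_le.mpr hlt)
  obtain ⟨φ, u, v, hu, huv, hv⟩ := geometric_hahn_banach_compact_closed hA (hK.image hΦc)
    (convex_Iic 0) isClosed_Iic hdisj
  have hv0 : v < 0 := by simpa using hv 0 (by simp)
  let c : s → ℝ := fun y => -φ (Pi.single y 1)
  have hc : ∀ y, 0 ≤ c y := by
    intro y
    by_contra! hneg
    have hpos : 0 < φ (Pi.single y 1) := by simpa [c] using hneg
    -- This point lies in the orthant because `v < 0`, yet `φ` takes the value `v` there, against
    -- strict separation.
    have h := hv ((v / φ (Pi.single y 1)) • Pi.single y 1) (by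
      intro z
      have hq : v / φ (Pi.single y 1) ≤ 0 := (div_neg_of_neg_of_pos hv0 hpos).le
      by_cases hz : z = y
      · subst hz; simpa using hq
      · simp [hz])
    rw [map_smul, smul_eq_mul, div_mul_cancel₀ _ hpos.ne'] at h
    exact lt_irrefl _ h
  have hφ : ∀ z, φ z = -∑ y, c y * z y := by
    intro z
    conv_lhs => rw [← Finset.univ_sum_single z, map_sum]
    rw [← Finset.sum_neg_distrib]
    refine Finset.sum_congr rfl fun y _ => ?_
    have : (Pi.single y (z y) : s → ℝ) = z y • Pi.single y 1 := by
      rw [← Pi.single_smul]; simp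
    rw [this, map_smul]
    simp [c, mul_comm]
  have hpos : ∀ x ∈ K, 0 < ∑ y, c y * Φ x y := by
    intro x hx
    have := hu _ ⟨x, hx, rfl⟩
    rw [hφ] at this
    linarith
  have hC : 0 < ∑ y, c y := by
    refine (Finset.sum_nonneg fun y _ => hc y).lt_of_ne fun h0 => ?_
    obtain ⟨x, hx⟩ := hne
    have hz := (Finset.sum_eq_zero_iff_of_nonneg fun y _ => hc y).1 h0.symm
    have := hpos x hx
    rw [Finset.sum_eq_zero fun y hy => by rw [hz y hy, zero_mul]] at this
    exact lt_irrefl _ this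
  -- At the barycentre with weights `c`, the positive sum becomes a double sum of `c y * c z * ⟪G y,
  -- z - y⟫`; symmetrizing in `y` and `z` makes it nonpositive by monotonicity.
  let x₀ : E := Finset.univ.centerMass c fun y : s => ((y : K) : E)
  have hx₀ : x₀ ∈ K := hconv.centerMass_mem (fun y _ => hc y) hC fun y _ => y.1.2
  have h1 := mul_pos hC (hpos x₀ hx₀)
  have h2 : (∑ y, c y) * ∑ y, c y * Φ x₀ y
      = ∑ y : s, ∑ z : s, c y * c z * ⟪G y, (z : E) - y⟫ := by
    rw [Finset.mul_sum]
    refine Finset.sum_congr rfl fun y _ => ?_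
    have : (∑ y, c y) • (x₀ - y) = ∑ z : s, c z • ((z : E) - y) := by
      simp only [smul_sub, Finset.sum_sub_distrib, ← Finset.sum_smul]
      simp only [x₀, Finset.centerMass]
      rw [smul_inv_smul₀ hC.ne']
    calc (∑ y, c y) * (c y * Φ x₀ y) = c y * ⟪G y, (∑ y, c y) • (x₀ - y)⟫ := by
          rw [inner_smul_right]; simp only [Φ]; ring
      _ = _ := by
          rw [this, inner_sum, Finset.mul_sum]
          refine Finset.sum_congr rfl fun z _ => ?_
          rw [inner_smul_right]; ring
  rw [h2] at h1
  have h3 : ∑ y : s, ∑ z : s, c y * c z * ⟪G y, (z : E) - y⟫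
      = ∑ y : s, ∑ z : s, c y * c z * ⟪G z, (y : E) - z⟫ := by
    rw [Finset.sum_comm]
    refine Finset.sum_congr rfl fun y _ => Finset.sum_congr rfl fun z _ => by ring
  have h4 : ∑ y : s, ∑ z : s, c y * c z * ⟪G y, (z : E) - y⟫
      + ∑ y : s, ∑ z : s, c y * c z * ⟪G z, (y : E) - z⟫ ≤ 0 := by
    rw [← Finset.sum_add_distrib]
    refine Finset.sum_nonpos fun y _ => ?_
    rw [← Finset.sum_add_distrib]
    refine Finset.sum_nonpos fun z _ => ?_
    have hm := mul_nonneg (mul_nonneg (hc y) (hc z)) (hG y y.1.2 z z.1.2)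
    have : ⟪G y - G z, (y : E) - z⟫ = -⟪G y, (z : E) - y⟫ - ⟪G z, (y : E) - z⟫ := by
      rw [inner_sub_left, ← neg_sub (z : E) y, inner_neg_right, inner_neg_right]
    rw [this] at hm
    linarith
  rw [← h3] at h4
  linarith

/-- A continuous monotone operator on a nonempty compact convex set has a solution of its
variational inequality. -/
theorem exists_forall_inner_sub_nonneg {E : Type*} [NormedAddCommGroup E]
    [InnerProductSpace ℝ E] {K : Set E} (hK : IsCompact K) (hconv : Convex ℝ K)
    (hne : K.Nonempty) {G : E → E} (hGc : Continuous G)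
    (hG : ∀ x ∈ K, ∀ y ∈ K, 0 ≤ ⟪G x - G y, x - y⟫) :
    ∃ x ∈ K, ∀ y ∈ K, 0 ≤ ⟪G x, y - x⟫ := by
  obtain ⟨x, hxK, hx⟩ := hK.inter_iInter_nonempty (fun y : K => {x | ⟪G y, x - y⟫ ≤ 0})
    (fun y => isClosed_le (by fun_prop) continuous_const) fun s => by
      obtain ⟨x, hxK, hx⟩ := exists_forall_finset_inner_sub_nonpos hK hconv hne hG s
      exact ⟨x, hxK, by simpa using fun y hy hs => hx ⟨y, hy⟩ hs⟩
  refine ⟨x, hxK, fun y hy => ?_⟩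
  -- Minty's trick: apply the inequality at a point of the segment from `x` to `y`, divide by `t`,
  -- and let `t` tend to 0 from the right.
  have hlim : Filter.Tendsto (fun t : ℝ => ⟪G (x + t • (y - x)), y - x⟫)
      (nhdsWithin 0 (Set.Ioi 0)) (nhds ⟪G x, y - x⟫) := by
    have hc : Continuous fun t : ℝ => ⟪G (x + t • (y - x)), y - x⟫ := by fun_prop
    simpa using (hc.tendsto 0).mono_left nhdsWithin_le_nhds
  refine ge_of_tendsto hlim ?_
  filter_upwards [Ioo_mem_nhdsGT (zero_lt_one (α := ℝ))] with t ht
  have hz : x + t • (y - x) ∈ K := hconv.add_smul_sub_mem hxK hy ⟨ht.1.le, ht.2.le⟩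
  have h : ⟪G (x + t • (y - x)), x - (x + t • (y - x))⟫ ≤ 0 := Set.mem_iInter.1 hx ⟨_, hz⟩
  rw [sub_add_cancel_left, inner_neg_right, inner_smul_right] at h
  exact nonneg_of_mul_nonneg_right (by linarith) ht.1

/-! ### Measurable dependence of a unique zero -/

/-- The unique zero of a nonnegative Carathéodory function with bounded sublevel sets depends
measurably on the parameter. -/
theorem measurable_of_unique_zero {Ω E : Type*} [MeasurableSpace Ω] [PseudoMetricSpace E]
    [ProperSpace E] [SecondCountableTopology E] [MeasurableSpace E] [BorelSpace E]
    {h : Ω → E → ℝ} (hc : ∀ ω, Continuous (h ω)) (hm : ∀ y, Measurable fun ω => h ω y)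
    (h0 : ∀ ω y, 0 ≤ h ω y) (hb : ∀ ω, Bornology.IsBounded {y | h ω y ≤ 1})
    {x : Ω → E} (hx : ∀ ω, h ω (x ω) = 0) (huniq : ∀ ω y, h ω y = 0 → y = x ω) :
    Measurable x := by
  classical
  rcases isEmpty_or_nonempty Ω with hΩ | ⟨⟨ω₀⟩⟩
  · exact measurable_of_empty x
  have : Nonempty E := ⟨x ω₀⟩
  let d := TopologicalSpace.denseSeq E
  have hex : ∀ (n : ℕ) ω, ∃ k, h ω (d k) < 1 / ((n : ℝ) + 1) := by
    intro n ω
    have hopen : IsOpen {y | h ω y < 1 / ((n : ℝ) + 1)} := isOpen_lt (hc ω) continuous_const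
    exact (TopologicalSpace.denseRange_denseSeq E).exists_mem_open hopen
      ⟨x ω, by change h ω (x ω) < _; rw [hx]; positivity⟩
  -- The approximants take the first point of a dense sequence where `h ω` is below `1 / (n + 1)`.
  -- They stay in the compact sublevel set at 1, and each cluster point is a zero of `h ω`, hence `x
  -- ω`.
  refine measurable_of_tendsto_metrizable
    (f := fun n ω => d (Nat.find (hex n ω))) (fun n => ?_) ?_
  · exact (measurable_from_nat (f := d)).comp
      (measurable_find (hex n) fun k => measurableSet_lt (hm _) measurable_const)
  · rw [tendsto_pi_nhds]
    intro ω
    have hlt : ∀ n, h ω (d (Nat.find (hex n ω))) < 1 / ((n : ℝ) + 1) :=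
      fun n => Nat.find_spec (hex n ω)
    have hK : IsCompact {y | h ω y ≤ 1} :=
      Metric.isCompact_of_isClosed_isBounded (isClosed_le (hc ω) continuous_const) (hb ω)
    refine hK.tendsto_nhds_of_unique_mapClusterPt (.of_forall fun n => ?_) fun y _ hy => ?_
    · refine (hlt n).le.trans ?_
      rw [div_le_one (by positivity)]
      simp
    · have hlim : Filter.Tendsto (fun n => h ω (d (Nat.find (hex n ω)))) Filter.atTop (nhds 0) :=
        squeeze_zero (fun n => h0 _ _) (fun n => (hlt n).le) tendsto_one_div_add_atTop_nhds_zero_nat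
      have hcl := hy.continuousAt_comp (hc ω).continuousAt
      exact huniq ω y (eq_of_nhds_neBot (ClusterPt.mono hcl hlim))

/-! ### The pointwise problem on a box -/

namespace Cournot

/-- The sign of `g` decides both sides: `g < 0` forces `x = b`, `g > 0` forces `x = 0`, and `g = 0`
leaves `x` free in the interval. This recasts the variational inequality as an equation. -/
theorem eq_max_min_sub_iff {b : ℝ} (hb : 0 ≤ b) (x g : ℝ) :
    x = max 0 (min b (x - g)) ↔
      (0 ≤ x ∧ x ≤ b) ∧ ∀ t, 0 ≤ t → t ≤ b → 0 ≤ g * (t - x) := by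
  constructor
  · intro h
    have h0 : 0 ≤ x := h ▸ le_max_left _ _
    have h1 : x ≤ b := by
      rw [h]; exact max_le hb (min_le_left _ _)
    refine ⟨⟨h0, h1⟩, fun t ht0 htb => ?_⟩
    rcases lt_trichotomy g 0 with hg | rfl | hg
    · have hxb : x = b := by
        by_contra hne
        have hlt : x < b := lt_of_le_of_ne h1 hne
        have : x < max 0 (min b (x - g)) := lt_max_of_lt_right (lt_min hlt (by linarith))
        linarith
      exact mul_nonneg_of_nonpos_of_nonpos hg.le (by linarith)
    · simp
    · have hx0 : x = 0 := by
        by_contra hne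
        have hlt : 0 < x := lt_of_le_of_ne h0 (Ne.symm hne)
        have : max 0 (min b (x - g)) < x :=
          max_lt hlt ((min_le_right _ _).trans_lt (by linarith))
        linarith
      exact mul_nonneg hg.le (by linarith)
  · rintro ⟨⟨h0, h1⟩, h⟩
    rcases lt_trichotomy g 0 with hg | rfl | hg
    · have hxb : x = b := by
        have := h b hb le_rfl
        nlinarith
      rw [min_eq_left (by linarith), max_eq_right hb, hxb]
    · rw [sub_zero, min_eq_right h1, max_eq_right h0]
    · have hx0 : x = 0 := by
        have := h 0 le_rfl hb
        nlinarith
      rw [hx0, min_eq_right (by linarith), max_eq_left (by linarith)]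

theorem isCompact_box {m : ℕ} (a b : Fin m → ℝ) :
    IsCompact {x : EuclideanSpace ℝ (Fin m) | ∀ i, a i ≤ x i ∧ x i ≤ b i} := by
  have h := ((EuclideanSpace.equiv (Fin m) ℝ).toHomeomorph.isCompact_preimage).2
    (isCompact_Icc (a := a) (b := b))
  convert h using 1
  ext x
  simp [Pi.le_def, forall_and]

/-- Pointwise variational inequality on a box: existence. -/
theorem StrictlyMonotone.exists_box_solution {m : ℕ} {b : Fin m → ℝ} (hb : ∀ i, 0 ≤ b i)
    {G : EuclideanSpace ℝ (Fin m) → Fin m → ℝ} (hG : StrictlyMonotone G) (hc : Continuous G) :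
    ∃ x : EuclideanSpace ℝ (Fin m), ∀ i, (0 ≤ x i ∧ x i ≤ b i) ∧
      ∀ t, 0 ≤ t → t ≤ b i → 0 ≤ G x i * (t - x i) := by
  have hin : ∀ x y z w : EuclideanSpace ℝ (Fin m),
      ⟪WithLp.toLp 2 (G x) - z, y - w⟫ = ∑ i, (G x i - z i) * (y i - w i) := by
    intro x y z w
    simp [PiLp.inner_apply, mul_comm]
  obtain ⟨x, hx, hvi⟩ := exists_forall_inner_sub_nonneg (isCompact_box 0 b) (by
      intro x hx y hy s t hs ht hst i
      have h1 := hx i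
      have h2 := hy i
      simp only [Pi.zero_apply, PiLp.add_apply, PiLp.smul_apply, smul_eq_mul] at *
      refine ⟨add_nonneg (mul_nonneg hs h1.1) (mul_nonneg ht h2.1), ?_⟩
      calc s * x i + t * y i ≤ s * b i + t * b i := by gcongr <;> linarith
        _ = b i := by rw [← add_mul, hst, one_mul])
    ⟨0, fun i => ⟨le_rfl, by simpa using hb i⟩⟩
    (G := fun x => WithLp.toLp 2 (G x)) (by fun_prop) (by
      intro x hx y hy
      rw [hin]
      rcases eq_or_ne x y with rfl | hxy
      · simp
      · exact (hG x y (fun i => (hx i).1) (fun i => (hy i).1) hxy).le)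
  refine ⟨x, fun i => ⟨hx i, fun t ht0 htb => ?_⟩⟩
  -- Changing only coordinate `i` stays in the box, which decouples the inequality into scalar ones.
  have h := hvi (x + EuclideanSpace.single i (t - x i)) (by
    intro j
    by_cases hj : j = i
    · subst hj; simpa using ⟨ht0, htb⟩
    · simpa [hj] using hx j)
  simpa [PiLp.inner_apply, mul_comm] using h

/-- Pointwise variational inequality on a box: uniqueness. -/
theorem StrictlyMonotone.box_solution_unique {m : ℕ} {b : Fin m → ℝ}
    {G : EuclideanSpace ℝ (Fin m) → Fin m → ℝ} (hG : StrictlyMonotone G)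
    {x y : EuclideanSpace ℝ (Fin m)}
    (hx : ∀ i, (0 ≤ x i ∧ x i ≤ b i) ∧ ∀ t, 0 ≤ t → t ≤ b i → 0 ≤ G x i * (t - x i))
    (hy : ∀ i, (0 ≤ y i ∧ y i ≤ b i) ∧ ∀ t, 0 ≤ t → t ≤ b i → 0 ≤ G y i * (t - y i)) :
    x = y := by
  by_contra hne
  refine (hG x y (fun i => (hx i).1.1) (fun i => (hy i).1.1) hne).not_ge
    (Finset.sum_nonpos fun i _ => ?_)
  have h1 := (hx i).2 _ (hy i).1.1 (hy i).1.2
  have h2 := (hy i).2 _ (hx i).1.1 (hx i).1.2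
  linarith

/-- The pointwise solutions on a random box form a measurable function. -/
theorem exists_measurable_box_solution {Ω : Type*} [MeasurableSpace Ω] {m : ℕ}
    {b : Fin m → Ω → ℝ} (hbm : ∀ i, Measurable (b i)) (hb : ∀ i ω, 0 ≤ b i ω)
    {F : Ω → EuclideanSpace ℝ (Fin m) → Fin m → ℝ} (hF : ∀ ω, StrictlyMonotone (F ω))
    (hFc : ∀ ω, Continuous (F ω)) (hFm : ∀ q, Measurable fun ω => F ω q) :
    ∃ x : Ω → EuclideanSpace ℝ (Fin m), Measurable x ∧
      ∀ ω i, (0 ≤ x ω i ∧ x ω i ≤ b i ω) ∧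
        ∀ t, 0 ≤ t → t ≤ b i ω → 0 ≤ F ω (x ω) i * (t - x ω i) := by
  choose x hx using fun ω => (hF ω).exists_box_solution (fun i => hb i ω) (hFc ω)
  refine ⟨x, ?_, hx⟩
  have hFc' : ∀ ω i, Continuous fun q => F ω q i := fun ω i =>
    (continuous_apply i).comp (hFc ω)
  have hFm' : ∀ q i, Measurable fun ω => F ω q i := fun q i =>
    (measurable_pi_apply i).comp (hFm q)
  have hzero : ∀ ω y, ∑ i, |y i - max 0 (min (b i ω) (y i - F ω y i))| = 0 ↔
      ∀ i, (0 ≤ y i ∧ y i ≤ b i ω) ∧ ∀ t, 0 ≤ t → t ≤ b i ω → 0 ≤ F ω y i * (t - y i) := by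
    intro ω y
    rw [Finset.sum_eq_zero_iff_of_nonneg fun i _ => abs_nonneg _]
    simp only [Finset.mem_univ, true_imp_iff, abs_eq_zero, sub_eq_zero,
      eq_max_min_sub_iff (hb _ ω)]
  refine measurable_of_unique_zero
    (h := fun ω y => ∑ i, |y i - max 0 (min (b i ω) (y i - F ω y i))|) (fun ω => ?_)
    (fun y => ?_) (fun ω y => Finset.sum_nonneg fun i _ => abs_nonneg _) (fun ω => ?_)
    (fun ω => (hzero ω _).2 (hx ω))
    (fun ω y hy => (hF ω).box_solution_unique ((hzero ω y).1 hy) (hx ω))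
  · exact continuous_finsetSum _ fun i _ => by have := hFc' ω i; fun_prop
  · exact Finset.measurable_sum _ fun i _ => by
      have := hFm' y i
      have := hbm i
      fun_prop
  -- The projected value lies in `[0, b i ω]`, so a residual of at most 1 confines `y i` to the
  -- interval enlarged by 1 on each side.
  · refine (isCompact_box (fun _ => -1) (fun i => b i ω + 1)).isBounded.subset fun y hy i => ?_
    have h1 : |y i - max 0 (min (b i ω) (y i - F ω y i))| ≤ 1 :=
      (Finset.single_le_sum (f := fun i => |y i - max 0 (min (b i ω) (y i - F ω y i))|)
        (fun i _ => abs_nonneg _) (Finset.mem_univ i)).trans hy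
    have h2 : 0 ≤ max 0 (min (b i ω) (y i - F ω y i)) := le_max_left _ _
    have h3 : max 0 (min (b i ω) (y i - F ω y i)) ≤ b i ω := max_le (hb i ω) (min_le_left _ _)
    obtain ⟨h4, h5⟩ := abs_le.1 h1
    exact ⟨by linarith, by linarith⟩

/-! ### Regularity of the Cournot operator -/

/-- The derivative is the pointwise limit of the measurable difference quotients with increments `1
/ (n + 1)`. -/
theorem measurable_deriv_of_forall_differentiableAt {Ω : Type*} [MeasurableSpace Ω]
    {g : Ω → ℝ → ℝ} (hm : ∀ x, Measurable fun ω => g ω x) (x : ℝ)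
    (hd : ∀ ω, DifferentiableAt ℝ (g ω) x) : Measurable fun ω => deriv (g ω) x := by
  refine measurable_of_tendsto_metrizable
    (f := fun (n : ℕ) ω => (1 / ((n : ℝ) + 1))⁻¹ • (g ω (x + 1 / ((n : ℝ) + 1)) - g ω x))
    (fun n => by
      have h1 := hm (x + 1 / ((n : ℝ) + 1))
      have h2 := hm x
      fun_prop) ?_
  rw [tendsto_pi_nhds]
  intro ω
  refine (hd ω).hasDerivAt.tendsto_slope_zero_right.comp
    (tendsto_nhdsWithin_iff.2 ⟨tendsto_one_div_add_atTop_nhds_zero_nat, ?_⟩)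
  exact .of_forall fun n => by simp only [Set.mem_Ioi]; positivity

theorem continuous_operator {m : ℕ} {f : Fin m → ℝ → ℝ} {p : ℝ → ℝ}
    (hf : ∀ i, ContDiff ℝ 1 (f i)) (hp : ContDiff ℝ 1 p) : Continuous (operator f p) := by
  refine continuous_pi fun i => ?_
  have h1 := (hf i).continuous_deriv le_rfl
  have h2 := hp.continuous_deriv le_rfl
  have h3 := hp.continuous
  unfold operator
  fun_prop

theorem measurable_operator {Ω : Type*} [MeasurableSpace Ω] {m : ℕ}
    {f : Fin m → Ω → ℝ → ℝ} {p : Ω → ℝ → ℝ}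
    (hfm : ∀ i x, Measurable fun ω => f i ω x) (hpm : ∀ x, Measurable fun ω => p ω x)
    (hf : ∀ i ω, Differentiable ℝ (f i ω)) (hp : ∀ ω, Differentiable ℝ (p ω))
    (q : EuclideanSpace ℝ (Fin m)) :
    Measurable fun ω => operator (fun j => f j ω) (p ω) q := by
  refine measurable_pi_lambda _ fun i => ?_
  exact ((measurable_deriv_of_forall_differentiableAt (hfm i) _ fun ω => hf i ω _).sub
    ((measurable_deriv_of_forall_differentiableAt hpm _ fun ω => hp ω _).mul_const _)).sub
    (hpm _)

/-- For these data the operator is the identity. They serve as default data on the exceptional null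
set. -/
theorem strictlyMonotone_operator_sq {m : ℕ} :
    StrictlyMonotone (operator (m := m) (fun _ x => x ^ 2 / 2) fun _ => 0) := by
  intro q q' _ _ hne
  have hop : ∀ (q : EuclideanSpace ℝ (Fin m)) i,
      operator (fun _ x => x ^ 2 / 2) (fun _ => 0) q i = q i := by
    intro q i
    simp [operator]
  simp only [hop]
  obtain ⟨i, hi⟩ : ∃ i, q i ≠ q' i := by
    by_contra! h
    exact hne (PiLp.ext h)
  exact Finset.sum_pos' (fun j _ => mul_self_nonneg _)
    ⟨i, Finset.mem_univ i, mul_self_pos.2 (sub_ne_zero.2 hi)⟩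

end Cournot

namespace Cournot

/-- Almost everywhere regularity of the data allows one to replace the Cournot operator, off a
null set, by an operator that is regular for every state of nature. -/
theorem exists_regular_modification {Ω : Type*} [MeasurableSpace Ω] {P : Measure Ω} {m : ℕ}
    {f : Fin m → Ω → ℝ → ℝ} {p : Ω → ℝ → ℝ}
    (hf_meas : ∀ i, ∀ x : ℝ, Measurable (fun ω => f i ω x))
    (hp_meas : ∀ x : ℝ, Measurable (fun ω => p ω x))
    (hf_C1 : ∀ i, ∀ᵐ ω ∂P, ContDiff ℝ 1 (f i ω)) (hp_C1 : ∀ᵐ ω ∂P, ContDiff ℝ 1 (p ω))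
    (h_mono : ∀ᵐ ω ∂P, StrictlyMonotone (operator (fun j => f j ω) (p ω))) :
    ∃ F : Ω → EuclideanSpace ℝ (Fin m) → Fin m → ℝ, (∀ ω, StrictlyMonotone (F ω)) ∧
      (∀ ω, Continuous (F ω)) ∧ (∀ q, Measurable fun ω => F ω q) ∧
      ∀ᵐ ω ∂P, F ω = operator (fun j => f j ω) (p ω) := by
  classical
  obtain ⟨S, hS, hSm, hgood⟩ :=
    ((Filter.eventually_all.2 hf_C1).and (hp_C1.and h_mono)).exists_measurable_mem
  let f' : Fin m → Ω → ℝ → ℝ := fun i ω => if ω ∈ S then f i ω else fun x => x ^ 2 / 2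
  let p' : Ω → ℝ → ℝ := fun ω => if ω ∈ S then p ω else fun _ => 0
  have hf1 : ∀ i ω, ContDiff ℝ 1 (f' i ω) := by
    intro i ω
    by_cases h : ω ∈ S
    · simpa only [f', if_pos h] using (hgood ω h).1 i
    · simp only [f', if_neg h]
      fun_prop
  have hp1 : ∀ ω, ContDiff ℝ 1 (p' ω) := by
    intro ω
    by_cases h : ω ∈ S
    · simpa only [p', if_pos h] using (hgood ω h).2.1
    · simp only [p', if_neg h]
      fun_prop
  refine ⟨fun ω => operator (fun j => f' j ω) (p' ω), fun ω => ?_,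
    fun ω => continuous_operator (fun i => hf1 i ω) (hp1 ω),
    measurable_operator (fun i x => ?_) (fun x => ?_)
      (fun i ω => (hf1 i ω).differentiable one_ne_zero)
      fun ω => (hp1 ω).differentiable one_ne_zero, ?_⟩
  · by_cases h : ω ∈ S
    · simpa only [f', p', if_pos h] using (hgood ω h).2.2
    · simpa only [f', p', if_neg h] using strictlyMonotone_operator_sq
  · have : (fun ω => f' i ω x) = fun ω => if ω ∈ S then f i ω x else x ^ 2 / 2 := by
      ext ω
      simp only [f']
      split_ifs <;> rfl
    rw [this]
    exact (hf_meas i x).ite hSm measurable_const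
  · have : (fun ω => p' ω x) = fun ω => if ω ∈ S then p ω x else 0 := by
      ext ω
      simp only [p']
      split_ifs <;> rfl
    rw [this]
    exact (hp_meas x).ite hSm measurable_const
  · filter_upwards [hS] with ω h
    simp only [f', p', if_pos h]

/-- Under the growth condition, a Carathéodory superposition operator maps `L^r` to `L^{r'}`. -/
theorem memLp_superposition {Ω : Type*} [MeasurableSpace Ω] {P : Measure Ω} {m : ℕ} {r : ℝ}
    (hr : 1 < r) {F : Ω → EuclideanSpace ℝ (Fin m) → Fin m → ℝ}
    (hFc : ∀ ω, Continuous (F ω)) (hFm : ∀ q, Measurable fun ω => F ω q)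
    {α : Ω → ℝ} {β : Ω → ℝ} {i : Fin m}
    (hα : MemLp α (ENNReal.ofReal (r / (r - 1))) P) (hβ : MemLp β ⊤ P)
    (u : Lp (EuclideanSpace ℝ (Fin m)) (ENNReal.ofReal r) P)
    (hg : ∀ᵐ ω ∂P, |F ω (u ω) i| ≤ α ω + β ω * ‖u ω‖ ^ (r - 1)) :
    MemLp (fun ω => F ω (u ω) i) (ENNReal.ofReal (r / (r - 1))) P := by
  -- Raising the norm of an L^r function to the power `r - 1` gives a function in L^{r/(r-1)}, and
  -- multiplication by the bounded `β` keeps it there.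
  have hu := (Lp.memLp u).norm_rpow_div (ENNReal.ofReal (r - 1))
  rw [← ENNReal.ofReal_div_of_pos (sub_pos.2 hr), ENNReal.toReal_ofReal (sub_pos.2 hr).le] at hu
  refine (hα.add (hu.mul hβ)).of_le ?_ ?_
  · have h1 := measurable_uncurry_of_continuous_of_measurable (u := fun q ω => F ω q)
      hFc hFm
    have h2 := h1.comp ((Lp.stronglyMeasurable u).measurable.prodMk measurable_id)
    exact ((measurable_pi_apply i).comp h2).aestronglyMeasurable
  · filter_upwards [hg] with ω hω
    exact hω.trans (le_abs_self _)

end Cournot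

/-! ### Existence and uniqueness in L^r -/

theorem mainTheorem1 {Ω : Type*} [MeasurableSpace Ω] (P : Measure Ω) [IsProbabilityMeasure P]
    (m : ℕ) (r : ℝ) (hr : 2 ≤ r)
    (f : Fin m → Ω → ℝ → ℝ) (p : Ω → ℝ → ℝ) (qbar : Fin m → Ω → ℝ)
    (hf_meas : ∀ i, ∀ x : ℝ, Measurable (fun ω => f i ω x))
    (hp_meas : ∀ x : ℝ, Measurable (fun ω => p ω x))
    (hf_C1 : ∀ i, ∀ᵐ ω ∂P, ContDiff ℝ 1 (f i ω))
    (hp_C1 : ∀ᵐ ω ∂P, ContDiff ℝ 1 (p ω))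
    (hqbar_Lr : ∀ i, MemLp (qbar i) (ENNReal.ofReal r) P)
    (hqbar_nonneg : ∀ i, ∀ᵐ ω ∂P, 0 ≤ qbar i ω)
    (h_mono : ∀ᵐ ω ∂P, Cournot.StrictlyMonotone (Cournot.operator (fun j => f j ω) (p ω)))
    (α : Ω → ℝ) (β : Fin m → Ω → ℝ)
    (hα : MemLp α (ENNReal.ofReal (r / (r - 1))) P)
    (hβ : ∀ i, MemLp (β i) ⊤ P)
    (h_growth : ∀ᵐ ω ∂P, ∀ i, ∀ q : EuclideanSpace ℝ (Fin m), (∀ j, 0 ≤ q j) →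
      |Cournot.operator (fun j => f j ω) (p ω) q i| ≤ α ω + β i ω * ‖q‖ ^ (r - 1)) :
    ∃! ustar : Lp (EuclideanSpace ℝ (Fin m)) (ENNReal.ofReal r) P,
      Cournot.IsSolution P r f p qbar ustar := by
  obtain ⟨F, hFmono, hFc, hFm, hFeq⟩ :=
    Cournot.exists_regular_modification hf_meas hp_meas hf_C1 hp_C1 h_mono
  have hr1 : 1 < r := by linarith
  have hint : ∀ v ∈ Cournot.feasibleSet P r qbar, ∀ u ∈ Cournot.feasibleSet P r qbar,
      Integrable (fun ω => ∑ i, Cournot.operator (fun j => f j ω) (p ω) (v ω) i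
        * (u ω i - v ω i)) P := by
    intro v hv u _
    refine integrable_finsetSum _ fun i _ => ?_
    have hF : MemLp (fun ω => F ω (v ω) i) (ENNReal.ofReal (r / (r - 1))) P := by
      refine Cournot.memLp_superposition hr1 hFc hFm hα (hβ i) v ?_
      have hv' : ∀ᵐ ω ∂P, ∀ i, 0 ≤ v ω i ∧ v ω i ≤ qbar i ω := hv
      filter_upwards [hFeq, h_growth, hv'] with ω h1 h2 h3
      rw [h1]
      exact h2 i _ fun j => (h3 j).1
    have hd : MemLp (fun ω => u ω i - v ω i) (ENNReal.ofReal r) P :=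
      ((Lp.memLp u).eval_piLp i).sub ((Lp.memLp v).eval_piLp i)
    have : ENNReal.HolderConjugate (ENNReal.ofReal (r / (r - 1))) (ENNReal.ofReal r) :=
      (Real.HolderConjugate.conjExponent hr1).symm.ennrealOfReal
    refine (MemLp.integrable_mul (p := ENNReal.ofReal (r / (r - 1))) hF hd).congr ?_
    filter_upwards [hFeq] with ω h1
    simp only [Pi.mul_apply, h1]
  have hqm : ∀ i, AEMeasurable (qbar i) P := fun i => (hqbar_Lr i).1.aemeasurable
  -- A version of `qbar` that is measurable and nonnegative for every ω, as the pointwise selection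
  -- requires.
  let b : Fin m → Ω → ℝ := fun i ω => max 0 ((hqm i).mk _ ω)
  have hbq : ∀ᵐ ω ∂P, ∀ i, b i ω = qbar i ω := by
    rw [ae_all_iff]
    intro i
    filter_upwards [(hqm i).ae_eq_mk, hqbar_nonneg i] with ω h1 h2
    simp only [b, ← h1, max_eq_right h2]
  obtain ⟨x, hxm, hx⟩ := Cournot.exists_measurable_box_solution (b := b)
    (fun i => measurable_const.max (hqm i).measurable_mk) (fun i ω => le_max_left _ _)
    hFmono hFc hFm
  have hxLp : MemLp x (ENNReal.ofReal r) P := by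
    refine MemLp.of_eval_piLp fun i => (hqbar_Lr i).of_le (by fun_prop) ?_
    filter_upwards [hbq] with ω h
    rw [Real.norm_of_nonneg (hx ω i).1.1, ← h i, Real.norm_of_nonneg (le_max_left _ _)]
    exact (hx ω i).1.2
  have hfeas : hxLp.toLp x ∈ Cournot.feasibleSet P r qbar := by
    change ∀ᵐ ω ∂P, _
    filter_upwards [hxLp.coeFn_toLp, hbq] with ω h1 h2 i
    rw [h1, ← h2 i]
    exact (hx ω i).1
  have hsol : Cournot.IsSolution P r f p qbar (hxLp.toLp x) := by
    refine ⟨hfeas, fun u hu => ⟨hint _ hfeas u hu, integral_nonneg_of_ae ?_⟩⟩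
    have hu' : ∀ᵐ ω ∂P, ∀ i, 0 ≤ u ω i ∧ u ω i ≤ qbar i ω := hu
    filter_upwards [hxLp.coeFn_toLp, hbq, hFeq, hu'] with ω h1 h2 h3 h4
    refine Finset.sum_nonneg fun i _ => ?_
    rw [h1, ← h3]
    exact (hx ω i).2 _ (h4 i).1 (h2 i ▸ (h4 i).2)
  refine ⟨_, hsol, fun v hv => ?_⟩
  obtain ⟨hvK, hvI⟩ := hv
  obtain ⟨huK, huI⟩ := hsol
  generalize hxLp.toLp x = u at huK huI
  obtain ⟨hi1, h1⟩ := hvI u huK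
  obtain ⟨hi2, h2⟩ := huI v hvK
  have hvK' : ∀ᵐ ω ∂P, ∀ i, 0 ≤ v ω i ∧ v ω i ≤ qbar i ω := hvK
  have huK' : ∀ᵐ ω ∂P, ∀ i, 0 ≤ u ω i ∧ u ω i ≤ qbar i ω := huK
  -- The monotonicity expression is minus the sum of the two integrands obtained by testing each
  -- solution against the other, so its integral is at most 0.
  have hsum : ∀ ω, (∑ i, (Cournot.operator (fun j => f j ω) (p ω) (v ω) i
      - Cournot.operator (fun j => f j ω) (p ω) (u ω) i) * (v ω i - u ω i))
      = -((∑ i, Cournot.operator (fun j => f j ω) (p ω) (v ω) i * (u ω i - v ω i))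
        + ∑ i, Cournot.operator (fun j => f j ω) (p ω) (u ω) i * (v ω i - u ω i)) := by
    intro ω
    rw [← Finset.sum_add_distrib, ← Finset.sum_neg_distrib]
    exact Finset.sum_congr rfl fun i _ => by ring
  have hpos : ∀ᵐ ω ∂P, v ω ≠ u ω → 0 < ∑ i, (Cournot.operator (fun j => f j ω) (p ω) (v ω) i
      - Cournot.operator (fun j => f j ω) (p ω) (u ω) i) * (v ω i - u ω i) := by
    filter_upwards [h_mono, hvK', huK'] with ω hm h3 h4 hne
    exact hm _ _ (fun i => (h3 i).1) (fun i => (h4 i).1) hne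
  have hnn : 0 ≤ᵐ[P] fun ω => ∑ i, (Cournot.operator (fun j => f j ω) (p ω) (v ω) i
      - Cournot.operator (fun j => f j ω) (p ω) (u ω) i) * (v ω i - u ω i) := by
    filter_upwards [hpos] with ω h
    by_cases he : v ω = u ω
    · simp [he]
    · exact (h he).le
  have hI : Integrable (fun ω => ∑ i, (Cournot.operator (fun j => f j ω) (p ω) (v ω) i
      - Cournot.operator (fun j => f j ω) (p ω) (u ω) i) * (v ω i - u ω i)) P := by
    simp only [hsum]
    exact (hi1.add hi2).neg
  have hzero := (integral_eq_zero_iff_of_nonneg_ae hnn hI).1 (by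
    refine le_antisymm ?_ (integral_nonneg_of_ae hnn)
    simp only [hsum]
    rw [integral_neg, integral_add hi1 hi2]
    linarith)
  refine Lp.ext ?_
  filter_upwards [hzero, hpos] with ω h3 h4
  by_contra hne
  exact (h4 hne).ne' h3
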